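/- Let $K$ be a field, let $0<a<b$ be integers with $\gcd(a,b)=1$, and let $I=(x^{a+b},\,x^b y^a,\,x^a y^b,\,y^{a+b})\subset K[x,y]$. Let $F(I)=R(I)/\mathfrak m R(I)$ be the fiber cone of $I$, where $R(I)=\bigoplus_{k\ge 0} I^k$ is the Rees ring of $I$ and $\mathfrak m=(x,y)$. Then $F(I)$ is isomorphic, as a $K$-algebra, to the homogeneous coordinate ring $K[S]$ of the projective monomial curve in $\mathbb P^3$ defined by $a<b<a+b$, that is, to the semigroup ring over $K$ of the submonoid $S\subset\mathbb N^2$ generated by $(0,a+b),(a,b),(b,a),(a+b,0)$. Moreover, $F(I)$ is Cohen–Macaulay if and only if $b=a+1$. -/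

import Mathlib

/-- The depth of a local ring: the supremum of the lengths of the regular sequences
contained in its maximal ideal. -/
noncomputable def localRingDepth (R : Type*) [CommRing R] [IsLocalRing R] : ℕ∞ :=
  ⨆ rs : {rs : List R // (∀ r ∈ rs, r ∈ IsLocalRing.maximalIdeal R) ∧
    RingTheory.Sequence.IsRegular R rs}, (rs.1.length : ℕ∞)

/-- A commutative ring is Cohen–Macaulay if it is Noetherian and, for each of its maximal ideals,
the depth of the localization there equals its Krull dimension. -/
structure IsCohenMacaulayRing (R : Type*) [CommRing R] : Prop where
  isNoetherianRing : IsNoetherianRing R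
  depth_eq_dim : ∀ (m : Ideal R) [m.IsMaximal],
    (localRingDepth (Localization.AtPrime m) : WithBot ℕ∞) =
      ringKrullDim (Localization.AtPrime m)

/-- The ideal of a polynomial ring over a field generated by all the variables. -/
noncomputable def variablesIdeal (σ K : Type*) [Field K] : Ideal (MvPolynomial σ K) :=
  Ideal.span (Set.range MvPolynomial.X)

/-- The fiber cone `F(I) = R(I) / 𝔪 R(I)` of an ideal of a polynomial ring, where `R(I)` is the
Rees algebra of `I` and `𝔪` is the ideal generated by the variables. -/
abbrev FiberCone {σ K : Type*} [Field K] (I : Ideal (MvPolynomial σ K)) : Type _ :=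
  reesAlgebra I ⧸ (variablesIdeal σ K).map (algebraMap (MvPolynomial σ K) (reesAlgebra I))

open MvPolynomial in
/-- The ideal `(x ^ c, x ^ b * y ^ a, x ^ a * y ^ b, y ^ c)` of `K[x, y]`, where `x = X 0` and
`y = X 1`. -/
noncomputable def symmetricIdeal (K : Type*) [Field K] (a b c : ℕ) :
    Ideal (MvPolynomial (Fin 2) K) :=
  Ideal.span {X 0 ^ c, X 0 ^ b * X 1 ^ a, X 0 ^ a * X 1 ^ b, X 1 ^ c}

/-- The affine semigroup in `ℕ²` attached to the projective monomial curve in `ℙ³` defined by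
`0 < a < b < c`. -/
def monomialCurveSemigroup (a b c : ℕ) : AddSubmonoid (ℕ × ℕ) :=
  AddSubmonoid.closure {(0, c), (a, c - a), (b, c - b), (c, 0)}

/-- The homogeneous coordinate ring over `K` of the projective monomial curve in `ℙ³` defined by
`0 < a < b < c`: the semigroup ring of the affine semigroup of the curve. -/
abbrev MonomialCurveRing (K : Type*) [Field K] (a b c : ℕ) : Type _ :=
  AddMonoidAlgebra K (monomialCurveSemigroup a b c)

/-! All generators of `I` have degree `a + b`, so `I ^ n / 𝔪 I ^ n` has as basis the monomials of
degree `n * (a + b)` in `I ^ n`. These are the monomials with exponents in the degree-`n` part of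
`S`, whence `F(I) ≅ K[S]` (`monomialCurveRingToFiberCone`).

The elements of `S` are `a(p, p') + b(q, q')` with `p + p' = q + q'`
(`mem_monomialCurveSemigroup_iff`). For `b = a + 1`, the ring `K[S]` is free over the polynomial
ring on the two extremal monomials, with basis the multiples `m(b, a)` and `m(a, b)`, `m ≤ a`. It is
then Cohen–Macaulay, since a regular pair of the polynomial ring stays regular under flat extension.

For `b ≥ a + 2`, the vector `e = (a(b - 1), b(b - 2) - a)` lies outside `S`, but `e + s ∈ S` for
every nonzero `s ∈ S`. With `u = (a + b, 0)` and `w = u + e`, the monomial of `w` is not in the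
ideal of the monomial of `u`, but is multiplied into it by the maximal ideal at the origin. The
depth there is at most one, while the dimension is at least two. -/

open IsLocalRing RingTheory.Sequence
open AddMonoidAlgebra (single)

/-! ### Depth and Cohen–Macaulayness -/

/-- A ring isomorphism of local rings does not decrease the depth. -/
theorem localRingDepth_le_of_ringEquiv {R S : Type*} [CommRing R] [IsLocalRing R] [CommRing S]
    [IsLocalRing S] (e : R ≃+* S) : localRingDepth R ≤ localRingDepth S := by
  refine iSup_le fun ⟨rs, hrs, hreg⟩ => ?_
  have hmem : ∀ s ∈ rs.map e, s ∈ maximalIdeal S := by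
    intro s hs
    obtain ⟨r, hr, rfl⟩ := List.mem_map.mp hs
    have := hrs r hr
    rw [mem_maximalIdeal, mem_nonunits_iff] at this ⊢
    simpa using this
  have hreg' : IsRegular S (rs.map e) := by
    refine (AddEquiv.isRegular_congr (e := e.toAddEquiv) ?_).mp hreg
    rw [List.forall₂_map_right_iff]
    exact List.forall₂_same.mpr fun r _ x => by simp
  refine le_trans ?_ (le_iSup (fun rs : {rs : List S // (∀ r ∈ rs, r ∈ maximalIdeal S) ∧
    IsRegular S rs} => (rs.1.length : ℕ∞)) ⟨rs.map e, hmem, hreg'⟩)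
  simp

/-- The depth of a local ring is invariant under ring isomorphisms. -/
theorem localRingDepth_eq_of_ringEquiv {R S : Type*} [CommRing R] [IsLocalRing R] [CommRing S]
    [IsLocalRing S] (e : R ≃+* S) : localRingDepth R = localRingDepth S :=
  le_antisymm (localRingDepth_le_of_ringEquiv e) (localRingDepth_le_of_ringEquiv e.symm)

/-- Being Cohen–Macaulay is invariant under ring isomorphisms. -/
theorem IsCohenMacaulayRing.of_ringEquiv {R S : Type*} [CommRing R] [CommRing S] (e : R ≃+* S)
    (h : IsCohenMacaulayRing R) : IsCohenMacaulayRing S where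
  isNoetherianRing := by
    have := h.isNoetherianRing
    exact isNoetherianRing_of_ringEquiv R e
  depth_eq_dim m hm := by
    have : (m.comap e).IsMaximal := Ideal.comap_isMaximal_of_equiv e
    have hmap : (m.comap e).primeCompl.map e.toMonoidHom = m.primeCompl := by
      ext x
      refine ⟨?_, fun hx => ⟨e.symm x, ?_, by simp⟩⟩
      · rintro ⟨y, hy, rfl⟩
        exact hy
      · simpa [Ideal.primeCompl] using hx
    have E : Localization.AtPrime (m.comap e) ≃+* Localization.AtPrime m :=
      IsLocalization.ringEquivOfRingEquiv _ _ e hmap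
    rw [← localRingDepth_eq_of_ringEquiv E, ← ringKrullDim_eq_of_ringEquiv E]
    exact h.depth_eq_dim _

/-- The depth of a Noetherian local ring is at most its Krull dimension. -/
theorem localRingDepth_le_ringKrullDim (R : Type*) [CommRing R] [IsLocalRing R]
    [IsNoetherianRing R] : (localRingDepth R : WithBot ℕ∞) ≤ ringKrullDim R := by
  obtain ⟨d, hd⟩ := WithBot.ne_bot_iff_exists.mp (ringKrullDim_ne_bot (R := R))
  rw [← hd, WithBot.coe_le_coe]
  refine iSup_le fun ⟨rs, hrs, hreg⟩ => ?_
  have hdim := ringKrullDim_add_length_eq_ringKrullDim_of_isRegular rs hreg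
  have : Nontrivial (R ⧸ Ideal.ofList rs) := by
    refine Ideal.Quotient.nontrivial_iff.mpr fun h => hreg.top_ne_smul ?_
    rw [h, Submodule.top_smul]
  have h0 : (0 : WithBot ℕ∞) ≤ ringKrullDim (R ⧸ Ideal.ofList rs) :=
    ringKrullDim_nonneg_of_nontrivial
  rw [← WithBot.coe_le_coe, hd, ← hdim]
  exact le_add_of_nonneg_left h0

theorem le_localRingDepth {R : Type*} [CommRing R] [IsLocalRing R] {rs : List R}
    (hrs : ∀ r ∈ rs, r ∈ maximalIdeal R) (h : IsRegular R rs) :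
    (rs.length : ℕ∞) ≤ localRingDepth R :=
  le_iSup (fun rs : {rs : List R // (∀ r ∈ rs, r ∈ maximalIdeal R) ∧
    IsRegular R rs} => (rs.1.length : ℕ∞)) ⟨rs, hrs, h⟩

/-- If some `w ∉ (u)` is multiplied into `(u)` by the maximal ideal of a local domain, with
`u ≠ 0`, then the domain has depth at most one. -/
theorem localRingDepth_le_one {R : Type*} [CommRing R] [IsLocalRing R] [IsDomain R] {u w : R}
    (hu : u ≠ 0) (hw : ¬ u ∣ w) (h : ∀ f ∈ maximalIdeal R, u ∣ f * w) :
    localRingDepth R ≤ 1 := by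
  refine iSup_le fun ⟨rs, hrs, hreg⟩ => ?_
  match rs, hrs, hreg with
  | [], _, _ => simp
  | [f], _, _ => simp
  | f :: g :: rs, hrs, hreg =>
    exfalso
    have hreg' := hreg.toIsWeaklyRegular
    rw [isWeaklyRegular_cons_iff, isWeaklyRegular_cons_iff] at hreg'
    obtain ⟨hf, hg, -⟩ := hreg'
    obtain ⟨p, hp⟩ := h f (hrs f (by simp))
    obtain ⟨q, hq⟩ := h g (hrs g (by simp))
    have hfg : f * q = g * p := mul_left_cancel₀ hu (by linear_combination g * hp - f * hq)
    -- As `g` is regular modulo `f`, the relation `f * q = g * p` forces `p = f * r`. Then `f * w =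
    -- u * f * r`, and cancelling `f` gives `u ∣ w`.
    have hp0 : (Submodule.Quotient.mk p : QuotSMulTop f R) = 0 := by
      refine hg ?_
      simp only [smul_zero]
      rw [← Submodule.Quotient.mk_smul, Submodule.Quotient.mk_eq_zero,
        Submodule.mem_smul_pointwise_iff_exists]
      exact ⟨q, trivial, hfg⟩
    rw [Submodule.Quotient.mk_eq_zero, Submodule.mem_smul_pointwise_iff_exists] at hp0
    obtain ⟨r, -, hr⟩ := hp0
    refine hw ⟨r, hf ?_⟩
    simp only [smul_eq_mul] at hr ⊢
    rw [hp, ← hr]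
    ring

/-- A domain is not Cohen–Macaulay if it has a maximal ideal `m` of height at least two such that
some `w` is multiplied into `(u)` by `m`, but not by any element outside of `m`. -/
theorem not_isCohenMacaulayRing {R : Type*} [CommRing R] [IsDomain R] (m P : Ideal R)
    [hm : m.IsMaximal] [P.IsPrime] (hP : P ≠ ⊥) (hPm : P < m) {u w : R} (hu : u ≠ 0)
    (h : ∀ f ∈ m, u ∣ f * w) (hw : ∀ f ∉ m, ¬ u ∣ f * w) : ¬ IsCohenMacaulayRing R := by
  intro hCM
  have hdepth : localRingDepth (Localization.AtPrime m) ≤ 1 := by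
    refine localRingDepth_le_one (u := algebraMap R _ u) (w := algebraMap R _ w) ?_ ?_ ?_
    · rwa [Ne, IsLocalization.to_map_eq_zero_iff _ m.primeCompl_le_nonZeroDivisors]
    · rintro ⟨r, hr⟩
      obtain ⟨⟨r, q⟩, rfl⟩ := IsLocalization.mk'_surjective m.primeCompl r
      refine hw q q.2 ⟨r, IsLocalization.injective (Localization.AtPrime m)
        m.primeCompl_le_nonZeroDivisors ?_⟩
      rw [map_mul, map_mul, hr, ← IsLocalization.mk'_spec (Localization.AtPrime m) r q]
      ring
    · intro f hf
      obtain ⟨⟨f, q⟩, rfl⟩ := IsLocalization.mk'_surjective m.primeCompl f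
      rw [IsLocalization.AtPrime.mk'_mem_maximal_iff (Localization.AtPrime m) m] at hf
      have hdvd := map_dvd (algebraMap R (Localization.AtPrime m)) (h f hf)
      rw [map_mul, ← IsLocalization.mk'_spec (Localization.AtPrime m) f q] at hdvd
      refine (IsUnit.dvd_mul_left (IsLocalization.map_units (Localization.AtPrime m) q)).mp ?_
      convert hdvd using 1
      ring
  have hdim : 2 ≤ ringKrullDim (Localization.AtPrime m) := by
    rw [IsLocalization.AtPrime.ringKrullDim_eq_height m]
    have := hCM.isNoetherianRing
    have h1 := Ideal.height_strict_mono_of_isPrime (I := ⊥) (bot_lt_iff_ne_bot.mpr hP)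
    have h2 := Ideal.height_strict_mono_of_isPrime hPm
    have h3 : (2 : ℕ∞) ≤ m.height := by
      rw [Ideal.height_bot] at h1
      exact (add_le_add_left (Order.one_le_iff_pos.mpr h1) 1).trans (Order.add_one_le_of_lt h2)
    exact WithBot.coe_le_coe.mpr h3
  rw [← hCM.depth_eq_dim m] at hdim
  have := (WithBot.coe_le_coe (a := (2 : ℕ∞)).mp hdim).trans hdepth
  exact absurd this (by norm_num)

/-! ### Finite flat algebras over `K[X][Y]` -/

/-- An integral extension does not increase the Krull dimension. -/
theorem ringKrullDim_le_of_isIntegral (A R : Type*) [CommRing A] [CommRing R] [Algebra A R]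
    [Algebra.IsIntegral A R] : ringKrullDim R ≤ ringKrullDim A :=
  Order.krullDim_le_of_strictMono (PrimeSpectrum.comap (algebraMap A R)) fun p q hpq => by
    -- Incomparability: strictly nested primes have strictly nested contractions.
    exact Ideal.IsIntegral.comap_lt_comap (R := A) (show p.asIdeal < q.asIdeal from hpq)

/-- Every maximal ideal of `K[X][Y]` contains a regular sequence of length two. -/
theorem Polynomial.exists_isWeaklyRegular_pair {K : Type*} [Field K]
    (n : Ideal (Polynomial (Polynomial K))) [hn : n.IsMaximal] :
    ∃ f ∈ n, ∃ g ∈ n, IsWeaklyRegular (Polynomial (Polynomial K)) [f, g] := by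
  have hmax := Polynomial.isMaximal_comap_C_of_isJacobsonRing n
  obtain ⟨p, hp⟩ := IsPrincipalIdealRing.principal (n.comap Polynomial.C)
  rw [← Ideal.span] at hp
  have hp0 : p ≠ 0 := by
    rintro rfl
    rw [hp, Ideal.span_singleton_zero] at hmax
    exact Polynomial.not_isField K (Ring.isField_iff_maximal_bot.mpr hmax)
  have hprime : Prime p := (Ideal.span_singleton_prime hp0).mp (hp ▸ hmax.isPrime)
  have hpn : Polynomial.C p ∈ n := by
    rw [← Ideal.mem_comap, hp]
    exact Ideal.mem_span_singleton_self p
  -- If `C p` divided all of `n`, then `Y ∉ n`, so `q * Y + i = 1` with `i ∈ n`; but `p` would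
  -- divide the constant coefficient of `i`, which is `1`.
  obtain ⟨g, hgn, hg⟩ : ∃ g ∈ n, ¬ Polynomial.C p ∣ g := by
    by_contra! H
    have hX : (Polynomial.X : Polynomial (Polynomial K)) ∉ n := fun hX =>
      hprime.not_isUnit (isUnit_of_dvd_one
        (by simpa using Polynomial.C_dvd_iff_dvd_coeff _ _ |>.mp (H _ hX) 1))
    obtain ⟨q, hq⟩ := hn.exists_inv hX
    obtain ⟨i, hi, hqi⟩ := hq
    have h0 := (Polynomial.C_dvd_iff_dvd_coeff _ _).mp (H i hi) 0
    rw [eq_sub_of_add_eq' hqi] at h0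
    exact hprime.not_isUnit (isUnit_of_dvd_one (by simpa using h0))
  refine ⟨_, hpn, g, hgn, ?_⟩
  rw [isWeaklyRegular_cons_iff, isWeaklyRegular_singleton_iff]
  refine ⟨fun x y hxy => mul_left_cancel₀ (Polynomial.C_ne_zero.mpr hp0) hxy, ?_⟩
  rw [isSMulRegular_iff_right_eq_zero_of_smul]
  intro x hx
  obtain ⟨x, rfl⟩ := Submodule.Quotient.mk_surjective _ x
  rw [← Submodule.Quotient.mk_smul, Submodule.Quotient.mk_eq_zero,
    Submodule.mem_smul_pointwise_iff_exists] at hx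
  rw [Submodule.Quotient.mk_eq_zero, Submodule.mem_smul_pointwise_iff_exists]
  obtain ⟨y, -, hy⟩ := hx
  obtain ⟨z, rfl⟩ := ((Polynomial.prime_C_iff.mpr hprime).dvd_or_dvd ⟨y, hy.symm⟩).resolve_left hg
  exact ⟨z, trivial, rfl⟩

/-- A finite flat algebra over `K[X][Y]` is Cohen–Macaulay. -/
theorem isCohenMacaulayRing_of_finite_of_flat (K : Type*) [Field K] (R : Type*) [CommRing R]
    [Algebra (Polynomial (Polynomial K)) R] [Module.Finite (Polynomial (Polynomial K)) R]
    [Module.Flat (Polynomial (Polynomial K)) R] : IsCohenMacaulayRing R where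
  isNoetherianRing := IsNoetherianRing.of_finite (Polynomial (Polynomial K)) R
  depth_eq_dim m hm := by
    have hR : IsNoetherianRing R := IsNoetherianRing.of_finite (Polynomial (Polynomial K)) R
    have hle := localRingDepth_le_ringKrullDim (Localization.AtPrime m)
    refine le_antisymm hle (le_trans (b := 2) ?_ ?_)
    · rw [IsLocalization.AtPrime.ringKrullDim_eq_height m]
      refine (Ideal.height_le_ringKrullDim_of_ne_top hm.ne_top).trans ?_
      refine (ringKrullDim_le_of_isIntegral (Polynomial (Polynomial K)) R).trans ?_
      rw [Polynomial.ringKrullDim_of_isNoetherianRing, Polynomial.ringKrullDim_of_isNoetherianRing,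
        ringKrullDim_eq_zero_of_field]
      norm_num
    -- A regular pair in the contraction of `m` stays regular in the localization by flatness, so
    -- the depth is at least two.
    · obtain ⟨f, hf, g, hg, hfg⟩ := Polynomial.exists_isWeaklyRegular_pair
        (m.comap (algebraMap (Polynomial (Polynomial K)) R))
      have hreg := (hfg.of_flat (S := R)).isRegular_of_isLocalization_of_mem
        (Localization.AtPrime m) m (by simpa using ⟨hf, hg⟩)
      have := le_localRingDepth (by
        simp only [List.map_cons, List.map_nil, List.mem_cons, List.not_mem_nil, or_false,
          forall_eq_or_imp, forall_eq,
          IsLocalization.AtPrime.to_map_mem_maximal_iff (Localization.AtPrime m) m]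
        exact ⟨hf, hg⟩) hreg
      exact WithBot.coe_le_coe.mpr this

/-! ### The semigroup of the curve -/

/-- The semigroup of the projective monomial curve defined by `a < b < a + b` is the image of the
semigroup of the Segre embedding of `ℙ¹ × ℙ¹`. -/
theorem mem_monomialCurveSemigroup_iff {a b : ℕ} {s : ℕ × ℕ} :
    s ∈ monomialCurveSemigroup a b (a + b) ↔ ∃ p p' q q' : ℕ, p + p' = q + q' ∧
      s = (a * p + b * q, a * p' + b * q') := by
  constructor
  · intro hs
    induction hs using AddSubmonoid.closure_induction with
    | mem x hx =>
      rcases hx with rfl | rfl | rfl | rfl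
      · exact ⟨0, 1, 0, 1, rfl, by simp⟩
      · exact ⟨1, 0, 0, 1, rfl, by simp⟩
      · exact ⟨0, 1, 1, 0, rfl, by simp⟩
      · exact ⟨1, 0, 1, 0, rfl, by simp⟩
    | zero => exact ⟨0, 0, 0, 0, rfl, rfl⟩
    | add x y _ _ hx hy =>
      obtain ⟨p, p', q, q', h, rfl⟩ := hx
      obtain ⟨r, r', t, t', h', rfl⟩ := hy
      exact ⟨p + r, p' + r', q + t, q' + t', by omega, by
        simp only [Prod.mk_add_mk]; congr 1 <;> ring⟩
  · rintro ⟨p, p', q, q', h, rfl⟩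
    induction hn : p + p' generalizing p p' q q' with
    | zero =>
      obtain ⟨rfl, rfl, rfl, rfl⟩ : p = 0 ∧ p' = 0 ∧ q = 0 ∧ q' = 0 := by omega
      exact zero_mem _
    | succ n ih =>
      have key : ∀ x y : ℕ × ℕ, x ∈ ({(0, a + b), (a, a + b - a), (b, a + b - b), (a + b, 0)} :
          Set (ℕ × ℕ)) → y ∈ monomialCurveSemigroup a b (a + b) →
          y + x ∈ monomialCurveSemigroup a b (a + b) := fun x y hx hy =>
        add_mem hy (AddSubmonoid.subset_closure hx)
      rcases p with _ | p
      · obtain ⟨p', rfl⟩ : ∃ r, p' = r + 1 := ⟨p' - 1, by omega⟩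
        rcases q with _ | q
        · obtain ⟨q', rfl⟩ : ∃ r, q' = r + 1 := ⟨q' - 1, by omega⟩
          convert key (0, a + b) _ (by simp) (ih 0 p' 0 q' (by omega) (by omega)) using 1
          simp only [Prod.mk_add_mk]; congr 1; ring
        · convert key (b, a) _ (by simp) (ih 0 p' q q' (by omega) (by omega)) using 1
          simp only [Prod.mk_add_mk]; congr 1 <;> ring
      · rcases q with _ | q
        · obtain ⟨q', rfl⟩ : ∃ r, q' = r + 1 := ⟨q' - 1, by omega⟩
          convert key (a, b) _ (by simp) (ih p p' 0 q' (by omega) (by omega)) using 1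
          simp only [Prod.mk_add_mk]; congr 1; ring
        · convert key (a + b, 0) _ (by simp) (ih p p' q q' (by omega) (by omega)) using 1
          simp only [Prod.mk_add_mk]; congr 1; ring

/-- Every element of the semigroup for `b = a + 1` is the sum of one of `2 * a + 1` elements and of
multiples of the extremal generators. -/
theorem exists_eq_add_of_mem_monomialCurveSemigroup {a : ℕ} {s : ℕ × ℕ}
    (hs : s ∈ monomialCurveSemigroup a (a + 1) (a + (a + 1))) :
    ∃ i < 2 * a + 1, ∃ j k : ℕ,
      -- Truncated subtraction merges two families: `(a - i)(b, a)` for `i ≤ a` and `(i - a)(a, b)`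
      -- for `i ≥ a`, where `b = a + 1`.
      s = (a * (i - a) + (a + 1) * (a - i) + j * (a + (a + 1)),
        (a + 1) * (i - a) + a * (a - i) + k * (a + (a + 1))) := by
  obtain ⟨p, p', q, q', h, rfl⟩ := mem_monomialCurveSemigroup_iff.mp hs
  clear hs
  induction hn : p + p' using Nat.strong_induction_on generalizing p p' q q' with
  | _ n ih =>
    subst hn
    by_cases h1 : 0 < p ∧ 0 < q
    · obtain ⟨i, hi, j, k, e⟩ := ih (p - 1 + p') (by omega) (p - 1) p' (q - 1) q' (by omega) rfl
      refine ⟨i, hi, j + 1, k, ?_⟩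
      obtain ⟨p, rfl⟩ : ∃ r, p = r + 1 := ⟨p - 1, by omega⟩
      obtain ⟨q, rfl⟩ : ∃ r, q = r + 1 := ⟨q - 1, by omega⟩
      simp only [Nat.add_sub_cancel, Prod.mk.injEq] at e ⊢
      exact ⟨by linear_combination e.1, e.2⟩
    by_cases h2 : 0 < p' ∧ 0 < q'
    · obtain ⟨i, hi, j, k, e⟩ := ih (p + (p' - 1)) (by omega) p (p' - 1) q (q' - 1) (by omega) rfl
      refine ⟨i, hi, j, k + 1, ?_⟩
      obtain ⟨p', rfl⟩ : ∃ r, p' = r + 1 := ⟨p' - 1, by omega⟩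
      obtain ⟨q', rfl⟩ : ∃ r, q' = r + 1 := ⟨q' - 1, by omega⟩
      simp only [Nat.add_sub_cancel, Prod.mk.injEq] at e ⊢
      exact ⟨e.1, by linear_combination e.2⟩
    rcases Nat.eq_zero_or_pos p with rfl | hp
    · obtain ⟨rfl, rfl⟩ : q' = 0 ∧ p' = q := by omega
      by_cases hq : p' ≤ a
      · refine ⟨a - p', by omega, 0, 0, ?_⟩
        rw [show a - p' - a = 0 by omega, show a - (a - p') = p' by omega]
        simp
      · obtain ⟨t, rfl⟩ : ∃ t, p' = t + (a + 1) := ⟨p' - (a + 1), by omega⟩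
        -- For `b = a + 1`, `(a + 1)(b, a) = a(a, b) + (2a + 1, 0)`, which splits off an extremal
        -- generator.
        obtain ⟨i, hi, j, k, e⟩ := ih (a + t) (by omega) a t t a (by omega) rfl
        refine ⟨i, hi, j + 1, k, ?_⟩
        simp only [Prod.mk.injEq] at e ⊢
        exact ⟨by linear_combination e.1, by linear_combination e.2⟩
    · obtain ⟨rfl, rfl, rfl⟩ : q = 0 ∧ p' = 0 ∧ p = q' := by omega
      by_cases hq : p ≤ a
      · refine ⟨a + p, by omega, 0, 0, ?_⟩
        rw [show a + p - a = p by omega, show a - (a + p) = 0 by omega]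
        simp
      · obtain ⟨t, rfl⟩ : ∃ t, p = t + (a + 1) := ⟨p - (a + 1), by omega⟩
        obtain ⟨i, hi, j, k, e⟩ := ih (t + a) (by omega) t a a t (by omega) rfl
        refine ⟨i, hi, j, k + 1, ?_⟩
        simp only [Prod.mk.injEq] at e ⊢
        exact ⟨by linear_combination e.1, by linear_combination e.2⟩

/-- The element `(a * (b - 1), b * (b - 2) - a)` is not in the semigroup. -/
theorem not_mem_monomialCurveSemigroup {a b : ℕ} (ha : 0 < a) (hab : a + 2 ≤ b)
    (hgcd : Nat.gcd a b = 1) :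
    (a * (b - 1), b * (b - 2) - a) ∉ monomialCurveSemigroup a b (a + b) := by
  rw [mem_monomialCurveSemigroup_iff]
  rintro ⟨p, p', q, q', h, e⟩
  obtain ⟨t, rfl⟩ : ∃ t, b = a + t + 2 := ⟨b - a - 2, by omega⟩
  set b := a + t + 2 with hb
  have hba : a ≤ b * (b - 2) := by
    have : b - 2 = a + t := by omega
    rw [this]; nlinarith
  simp only [Prod.mk.injEq] at e
  obtain ⟨e1, e2⟩ := e
  zify [hba, show 1 ≤ b by omega, show 2 ≤ b by omega] at e1 e2 h
  -- The first coordinate forces `p ≥ b - 1`, whereas the coordinate sum forces `p + p' = b - 2`.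
  have hdvd : (b : ℤ) ∣ p + 1 := by
    have h1 : (b : ℤ) ∣ a * (p + 1) := ⟨a - q, by linear_combination -e1⟩
    have hcop : IsCoprime (b : ℤ) a :=
      Nat.isCoprime_iff_coprime.mpr (Nat.Coprime.symm hgcd)
    exact hcop.dvd_of_dvd_mul_left h1
  have hple : (b : ℤ) ≤ p + 1 := Int.le_of_dvd (by positivity) hdvd
  have hsum : ((a : ℤ) + b) * (p + p') = (a + b) * (b - 2) := by
    linear_combination -e1 - e2 + b * h
  have := mul_left_cancel₀ (by positivity) hsum
  omega

/-- Adding a nonzero element of the semigroup to `(a * (b - 1), b * (b - 2) - a)` gives an element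
of the semigroup. -/
theorem add_mem_monomialCurveSemigroup {a b : ℕ} (ha : 0 < a) (hab : a + 2 ≤ b) {x : ℕ × ℕ}
    (hx : x ∈ monomialCurveSemigroup a b (a + b)) (hx0 : x ≠ 0) :
    x + (a * (b - 1), b * (b - 2) - a) ∈ monomialCurveSemigroup a b (a + b) := by
  rw [mem_monomialCurveSemigroup_iff] at hx ⊢
  obtain ⟨p, p', q, q', h, rfl⟩ := hx
  obtain ⟨t, rfl⟩ : ∃ t, b = a + t + 2 := ⟨b - a - 2, by omega⟩
  have e1 : a + t + 2 - 1 = a + t + 1 := by omega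
  have e2 : (a + t + 2) * (a + t + 2 - 2) - a =
      (a + t + 2) * (a + t) - a := by congr 1
  have e3 : a + ((a + t + 2) * (a + t) - a) = (a + t + 2) * (a + t) :=
    Nat.add_sub_cancel' (by nlinarith)
  rw [e1, e2]
  set r := (a + t + 2) * (a + t) - a
  -- The added vector has two integral representations `(p, p', q, q')`, namely `(b - 1, -1, 0, b -
  -- 2)` and `(-1, b - 1, a, b - 2 - a)`. Use the first if `p' > 0` and the second if `p > 0`; here
  -- `t = b - 2 - a ≥ 0`.
  rcases Nat.eq_zero_or_pos p with rfl | hp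
  · obtain ⟨p', rfl⟩ : ∃ r, p' = r + 1 := by
      refine ⟨p' - 1, (Nat.sub_add_cancel ?_).symm⟩
      by_contra! h0
      obtain ⟨rfl, rfl, rfl⟩ : p' = 0 ∧ q = 0 ∧ q' = 0 := by omega
      exact hx0 (by simp)
    refine ⟨a + t + 1, p', q, q' + (a + t), by omega, ?_⟩
    simp only [Prod.mk_add_mk, Prod.mk.injEq]
    exact ⟨by ring, by linear_combination e3⟩
  · obtain ⟨p, rfl⟩ : ∃ r, p = r + 1 := ⟨p - 1, by omega⟩
    refine ⟨p, p' + (a + t) + 1, q + a, q' + t, by omega, ?_⟩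
    simp only [Prod.mk_add_mk, Prod.mk.injEq]
    exact ⟨by ring, by linear_combination e3⟩

/-! ### Semigroup rings that are not Cohen–Macaulay -/

/-- Unique sums make the semigroup ring a domain, as `not_isCohenMacaulayRing` requires. -/
instance AddSubmonoid.uniqueSums_prod_nat (S : AddSubmonoid (ℕ × ℕ)) : UniqueSums S :=
  UniqueSums.of_injective_addHom (S.subtype : S →ₙ+ ℕ × ℕ) Subtype.val_injective inferInstance

/-- The restriction of the semigroup ring of `S ⊆ ℕ²` to the face of the elements of `S` with
vanishing first coordinate. -/
noncomputable def restrictToFace (K : Type*) [Field K] (S : AddSubmonoid (ℕ × ℕ)) :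
    AddMonoidAlgebra K S →ₐ[K] Polynomial K :=
  AddMonoidAlgebra.lift K (Polynomial K) S
    { toFun s := if s.toAdd.1.1 = 0 then Polynomial.X ^ s.toAdd.1.2 else 0
      map_one' := by simp
      -- A sum in `ℕ` vanishes only if both summands do, so the complement of the face spans an
      -- ideal.
      map_mul' s t := by
        by_cases hs : s.toAdd.1.1 = 0 <;> by_cases ht : t.toAdd.1.1 = 0 <;>
          simp [hs, ht, pow_add] }

theorem restrictToFace_single {K : Type*} [Field K] {S : AddSubmonoid (ℕ × ℕ)} (s : S) (r : K) :
    restrictToFace K S (single s r) =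
      r • if s.1.1 = 0 then (Polynomial.X : Polynomial K) ^ s.1.2 else 0 := by
  simp [restrictToFace]

/-- The constant coefficient of an element of the semigroup ring of `S ⊆ ℕ²`. -/
noncomputable def constantCoeff (K : Type*) [Field K] (S : AddSubmonoid (ℕ × ℕ)) :
    AddMonoidAlgebra K S →ₐ[K] K :=
  (Polynomial.aeval 0).comp (restrictToFace K S)

theorem constantCoeff_eq_coeff {K : Type*} [Field K] {S : AddSubmonoid (ℕ × ℕ)}
    (f : AddMonoidAlgebra K S) : constantCoeff K S f = f.coeff 0 := by
  induction f using AddMonoidAlgebra.induction_linear with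
  | zero => simp
  | add f g hf hg => simp [hf, hg]
  | single s r =>
    rw [constantCoeff, AlgHom.comp_apply, restrictToFace_single]
    by_cases hs : s = 0
    · subst hs
      simp
    · have : s.1.1 = 0 → s.1.2 ≠ 0 := fun h1 h2 => hs (Subtype.ext (Prod.ext h1 h2))
      simp only [map_smul, AddMonoidAlgebra.coeff_single, Finsupp.single_apply, hs, if_false]
      split_ifs with h
      · simp [this h]
      · simp

/-- If a semigroup `S ⊆ ℕ²` has a nonzero element on the second coordinate axis and an element
off that axis, and there are `u, w ∈ S` such that `w - u ∉ S` but `x + w - u ∈ S` for all nonzero `x ∈ S`, then the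
semigroup ring of `S` is not Cohen–Macaulay. -/
theorem not_isCohenMacaulayRing_addMonoidAlgebra (K : Type*) [Field K] {S : AddSubmonoid (ℕ × ℕ)}
    {p q u w : S} (hp : p.1.1 ≠ 0) (hq : q.1.1 = 0) (hq' : q.1.2 ≠ 0)
    (hw : ∀ y, u + y ≠ w) (h : ∀ x ≠ 0, ∃ y, u + y = x + w) :
    ¬ IsCohenMacaulayRing (AddMonoidAlgebra K S) := by
  have hmax : (RingHom.ker (constantCoeff K S)).IsMaximal :=
    RingHom.ker_isMaximal_of_surjective _ fun r => ⟨single 0 r, by simp [constantCoeff_eq_coeff]⟩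
  have hprime : (RingHom.ker (restrictToFace K S)).IsPrime := RingHom.ker_isPrime _
  refine not_isCohenMacaulayRing (RingHom.ker (constantCoeff K S))
    (RingHom.ker (restrictToFace K S)) (u := single u 1) (w := single w 1) ?_ ?_ ?_ ?_ ?_
  · refine (Submodule.ne_bot_iff _).mpr ⟨single p 1, ?_, by simp⟩
    simp [RingHom.mem_ker, restrictToFace_single, hp]
  · refine lt_of_le_of_ne (fun f hf => ?_) fun heq => ?_
    · rw [RingHom.mem_ker] at hf ⊢
      rw [constantCoeff, AlgHom.comp_apply, hf, map_zero]
    · have hmem : (single q 1 : AddMonoidAlgebra K S) ∈ RingHom.ker (constantCoeff K S) := by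
        simp [RingHom.mem_ker, constantCoeff, restrictToFace_single, hq, hq']
      rw [← heq, RingHom.mem_ker, restrictToFace_single, if_pos hq] at hmem
      simp at hmem
  · simp
  · intro f hf
    rw [RingHom.mem_ker, constantCoeff_eq_coeff] at hf
    rw [← AddMonoidAlgebra.sum_coeff_single f, Finsupp.sum, Finset.sum_mul]
    refine Finset.dvd_sum fun x hx => ?_
    obtain ⟨y, hy⟩ := h x (by rintro rfl; exact Finsupp.mem_support_iff.mp hx hf)
    refine ⟨single y (f.coeff x), ?_⟩
    rw [AddMonoidAlgebra.single_mul_single, AddMonoidAlgebra.single_mul_single, hy, mul_comm]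
  · rintro f hf ⟨r, hr⟩
    rw [RingHom.mem_ker, constantCoeff_eq_coeff] at hf
    -- Compare coefficients at `w`: the left side gives the constant coefficient of `f`, the right
    -- side `0` because `w ∉ u + S`.
    have h1 := congrArg (fun g : AddMonoidAlgebra K S => g.coeff (0 + w)) hr
    simp only [AddMonoidAlgebra.coeff_mul_single_add, mul_one] at h1
    rw [AddMonoidAlgebra.coeff_single_mul_of_forall_add_ne _ _ (by simpa using hw)] at h1
    exact hf h1

/-- The homogeneous coordinate ring of the projective monomial curve defined by `a < b < a + b` is
not Cohen–Macaulay for `b ≥ a + 2`. -/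
theorem not_isCohenMacaulayRing_monomialCurveRing (K : Type*) [Field K] {a b : ℕ} (ha : 0 < a)
    (hab : a + 2 ≤ b) (hgcd : Nat.gcd a b = 1) :
    ¬ IsCohenMacaulayRing (MonomialCurveRing K a b (a + b)) := by
  have hu : (a + b, 0) ∈ monomialCurveSemigroup a b (a + b) :=
    AddSubmonoid.subset_closure (by simp)
  have hq : (0, a + b) ∈ monomialCurveSemigroup a b (a + b) :=
    AddSubmonoid.subset_closure (by simp)
  have hu0 : ((a + b, 0) : ℕ × ℕ) ≠ 0 := by simp; omega
  refine not_isCohenMacaulayRing_addMonoidAlgebra K (p := ⟨_, hu⟩) (q := ⟨_, hq⟩) (u := ⟨_, hu⟩)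
    (w := ⟨_, add_mem_monomialCurveSemigroup ha hab hu hu0⟩) ?_ rfl ?_ ?_ ?_
  · simp; omega
  · simp; omega
  · rintro ⟨y, hy⟩ h
    refine not_mem_monomialCurveSemigroup ha hab hgcd ?_
    rwa [← add_left_cancel (congrArg Subtype.val h)]
  · rintro ⟨x, hx⟩ hx0
    refine ⟨⟨_, add_mem_monomialCurveSemigroup ha hab hx (by simpa using hx0)⟩, ?_⟩
    exact Subtype.ext (add_left_comm _ _ _)

/-! ### Cohen–Macaulay semigroup rings -/

open Polynomial in
/-- The homomorphism from `K[X][Y]` to a semigroup ring that sends the variables to the monomials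
of exponents `u` and `v`. -/
noncomputable def bivariateToAddMonoidAlgebra (K : Type*) [Field K] {S : Type*} [AddCommMonoid S]
    (u v : S) : K[X][X] →+* AddMonoidAlgebra K S :=
  eval₂RingHom (aeval (single u (1 : K))).toRingHom (single v 1)

open Polynomial in
theorem bivariateToAddMonoidAlgebra_monomial {K : Type*} [Field K] {S : Type*} [AddCommMonoid S]
    (u v : S) (j k : ℕ) (r : K) :
    bivariateToAddMonoidAlgebra K u v (monomial k (monomial j r)) = single (j • u + k • v) r := by
  simp [bivariateToAddMonoidAlgebra, aeval_monomial, AddMonoidAlgebra.single_pow,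
    AddMonoidAlgebra.single_mul_single]

open Polynomial in
/-- The semigroup ring of a semigroup in which every element is uniquely the sum of one of finitely
many elements and of multiples of two given elements is Cohen–Macaulay. -/
theorem isCohenMacaulayRing_addMonoidAlgebra (K : Type*) [Field K] {S : Type*} [AddCommMonoid S]
    {ι : Type*} [Finite ι] (u v : S) (d : ι → S)
    (hd : Function.Bijective fun x : ι × ℕ × ℕ => d x.1 + (x.2.1 • u + x.2.2 • v)) :
    IsCohenMacaulayRing (AddMonoidAlgebra K S) := by
  classical
  let : Algebra K[X][X] (AddMonoidAlgebra K S) := (bivariateToAddMonoidAlgebra K u v).toAlgebra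
  have hsmul (P : K[X][X]) (f : AddMonoidAlgebra K S) :
    P • f = bivariateToAddMonoidAlgebra K u v P * f := rfl
  -- Uniqueness of the decomposition lets each coefficient of `P` be read off separately, which
  -- yields linear independence.
  have hcoeff (P : K[X][X]) (i i' : ι) (j k : ℕ) :
      (P • single (d i') (1 : K)).coeff (d i + (j • u + k • v)) =
        if i' = i then (P.coeff k).coeff j else 0 := by
    induction P using Polynomial.induction_on' with
    | add P Q hP hQ =>
      rw [hsmul, map_add (bivariateToAddMonoidAlgebra K u v), add_mul, AddMonoidAlgebra.coeff_add,
        Finsupp.add_apply, ← hsmul, ← hsmul, hP, hQ]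
      split_ifs <;> simp
    | monomial k' P =>
      induction P using Polynomial.induction_on' with
      | add P Q hP hQ =>
        rw [map_add (monomial k'), hsmul, map_add (bivariateToAddMonoidAlgebra K u v), add_mul,
          AddMonoidAlgebra.coeff_add, Finsupp.add_apply,
          ← hsmul, ← hsmul, hP, hQ]
        split_ifs <;> simp
      | monomial j' r =>
        rw [hsmul, bivariateToAddMonoidAlgebra_monomial, AddMonoidAlgebra.single_mul_single, mul_one,
          AddMonoidAlgebra.coeff_single, Finsupp.single_apply, coeff_monomial]
        have := hd.1.eq_iff (a := (i', j', k')) (b := (i, j, k))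
        simp only [Prod.mk.injEq] at this
        rw [add_comm, this]
        by_cases hi : i' = i <;> by_cases hj : j' = j <;> by_cases hk : k' = k <;>
          simp [hi, hj, hk, coeff_monomial]
  have hli : LinearIndependent K[X][X] fun i => single (d i) (1 : K) := by
    rw [linearIndependent_iff']
    intro s P hP i hi
    ext k j
    have := congrArg (fun f : AddMonoidAlgebra K S => f.coeff (d i + (j • u + k • v))) hP
    simpa [AddMonoidAlgebra.coeff_sum, Finsupp.finsetSum_apply, hcoeff, hi] using this
  have hspan : ⊤ ≤ Submodule.span K[X][X] (Set.range fun i => single (d i) (1 : K)) := by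
    rintro f -
    induction f using AddMonoidAlgebra.induction_linear with
    | zero => exact zero_mem _
    | add f g hf hg => exact add_mem hf hg
    | single s r =>
      obtain ⟨⟨i, j, k⟩, rfl⟩ := hd.2 s
      convert Submodule.smul_mem _ (monomial k (monomial j r))
        (Submodule.subset_span (Set.mem_range_self i)) using 1
      rw [hsmul, bivariateToAddMonoidAlgebra_monomial, AddMonoidAlgebra.single_mul_single, mul_one,
        add_comm]
  have B := Module.Basis.mk hli hspan
  have := Module.Finite.of_basis B
  have := Module.Free.of_basis B
  exact isCohenMacaulayRing_of_finite_of_flat K _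

/-- The homogeneous coordinate ring of the projective monomial curve defined by
`a < a + 1 < 2 * a + 1` is Cohen–Macaulay. -/
theorem isCohenMacaulayRing_monomialCurveRing (K : Type*) [Field K] (a : ℕ) :
    IsCohenMacaulayRing (MonomialCurveRing K a (a + 1) (a + (a + 1))) := by
  have hu : (a + (a + 1), 0) ∈ monomialCurveSemigroup a (a + 1) (a + (a + 1)) :=
    AddSubmonoid.subset_closure (by simp)
  have hv : (0, a + (a + 1)) ∈ monomialCurveSemigroup a (a + 1) (a + (a + 1)) :=
    AddSubmonoid.subset_closure (by simp)
  have hd (i : Fin (2 * a + 1)) : (a * (i - a) + (a + 1) * (a - i), (a + 1) * (i - a) + a * (a - i))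
      ∈ monomialCurveSemigroup a (a + 1) (a + (a + 1)) :=
    mem_monomialCurveSemigroup_iff.mpr ⟨i - a, a - i, a - i, i - a, by omega, by
      simp only [Prod.mk.injEq, true_and]; ring⟩
  refine isCohenMacaulayRing_addMonoidAlgebra K ⟨_, hu⟩ ⟨_, hv⟩ (fun i => ⟨_, hd i⟩) ⟨?_, ?_⟩
  · rintro ⟨⟨i, hi⟩, j, k⟩ ⟨⟨i', hi'⟩, j', k'⟩ h
    have h := congrArg Subtype.val h
    simp only [AddSubmonoid.coe_add, AddSubmonoidClass.coe_nsmul, Prod.smul_mk, Prod.mk_add_mk,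
      smul_eq_mul, mul_zero, add_zero, zero_add, Prod.mk.injEq] at h
    obtain ⟨h1, h2⟩ := h
    obtain rfl : i = i' := by
      zify at h1
      have e1 : ((i - a : ℕ) : ℤ) - (a - i : ℕ) = i - a := by omega
      have e2 : ((i' - a : ℕ) : ℤ) - (a - i' : ℕ) = i' - a := by omega
      -- Modulo `2a + 1`, `2a ≡ -1` and `2(a + 1) ≡ 1`, so twice the first coordinate is congruent
      -- to `a - i`.
      have hdvd : (2 * a + 1 : ℤ) ∣ i - i' :=
        ⟨(i - a : ℕ) + (a - i : ℕ) + 2 * j - (i' - a : ℕ) - (a - i' : ℕ) - 2 * j', by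
          linear_combination e2 - e1 - 2 * h1⟩
      have := Int.eq_zero_of_abs_lt_dvd hdvd (by rw [abs_lt]; omega)
      omega
    have hj := Nat.eq_of_mul_eq_mul_right (by omega) (Nat.add_left_cancel h1)
    have hk := Nat.eq_of_mul_eq_mul_right (by omega) (Nat.add_left_cancel h2)
    rw [hj, hk]
  · rintro ⟨s, hs⟩
    obtain ⟨i, hi, j, k, rfl⟩ := exists_eq_add_of_mem_monomialCurveSemigroup hs
    exact ⟨⟨⟨i, hi⟩, j, k⟩, Subtype.ext (by simp)⟩

/-! ### The isomorphism with the fiber cone -/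

open MvPolynomial in
/-- The generators of `symmetricIdeal K a b (a + b)` are homogeneous of degree `a + b`. -/
theorem symmetricIdeal_le_variablesIdeal_pow (K : Type*) [Field K] (a b : ℕ) :
    symmetricIdeal K a b (a + b) ≤ variablesIdeal (Fin 2) K ^ (a + b) := by
  have hX (i : Fin 2) : (X i : MvPolynomial (Fin 2) K) ∈ variablesIdeal (Fin 2) K :=
    Ideal.subset_span ⟨i, rfl⟩
  refine Ideal.span_le.mpr ?_
  rintro _ (rfl | rfl | rfl | rfl)
  · exact Ideal.pow_mem_pow (hX 0) _
  · rw [add_comm, pow_add]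
    exact Ideal.mul_mem_mul (Ideal.pow_mem_pow (hX 0) _) (Ideal.pow_mem_pow (hX 1) _)
  · rw [pow_add]
    exact Ideal.mul_mem_mul (Ideal.pow_mem_pow (hX 0) _) (Ideal.pow_mem_pow (hX 1) _)
  · exact Ideal.pow_mem_pow (hX 1) _

/-- The extension to the Rees algebra of `I` of an ideal `J` has its coefficients of degree `n` in
`J * I ^ n`. -/
theorem coeff_mem_of_mem_map_reesAlgebra {R : Type*} [CommRing R] {I J : Ideal R}
    {r : reesAlgebra I} (hr : r ∈ J.map (algebraMap R (reesAlgebra I))) (n : ℕ) :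
    r.1.coeff n ∈ J * I ^ n := by
  induction hr using Submodule.span_induction generalizing n with
  | mem r hr =>
    obtain ⟨x, hx, rfl⟩ := hr
    change (Polynomial.C x).coeff n ∈ _
    rw [Polynomial.coeff_C]
    split_ifs with h
    · simpa [h] using hx
    · exact zero_mem _
  | zero => exact zero_mem _
  | add r s _ _ hr hs => exact add_mem (hr n) (hs n)
  | smul r s _ hs =>
    change (r.1 * s.1).coeff n ∈ _
    rw [Polynomial.coeff_mul]
    refine Ideal.sum_mem _ fun ⟨j, k⟩ hjk => ?_
    rw [← Finset.HasAntidiagonal.mem_antidiagonal.mp hjk, pow_add, mul_left_comm]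
    exact Ideal.mul_mem_mul (r.2 j) (hs k)

/-- The degree of an element of the semigroup of a projective monomial curve. -/
def monomialCurveDegree (c : ℕ) (s : ℕ × ℕ) : ℕ := (s.1 + s.2) / c

/-- The division is exact because the coordinate sum is `(a + b) * (p + p')`. -/
theorem monomialCurveDegree_mul {a b : ℕ} {s : ℕ × ℕ}
    (hs : s ∈ monomialCurveSemigroup a b (a + b)) :
    monomialCurveDegree (a + b) s * (a + b) = s.1 + s.2 := by
  obtain ⟨p, p', q, q', h, rfl⟩ := mem_monomialCurveSemigroup_iff.mp hs
  refine Nat.div_mul_cancel ⟨p + p', ?_⟩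
  linear_combination b * h.symm

theorem monomialCurveDegree_add {a b : ℕ} (hb : 0 < a + b) {s t : ℕ × ℕ}
    (hs : s ∈ monomialCurveSemigroup a b (a + b)) (ht : t ∈ monomialCurveSemigroup a b (a + b)) :
    monomialCurveDegree (a + b) (s + t) =
      monomialCurveDegree (a + b) s + monomialCurveDegree (a + b) t := by
  refine Nat.eq_of_mul_eq_mul_right hb ?_
  rw [add_mul, monomialCurveDegree_mul hs, monomialCurveDegree_mul ht,
    monomialCurveDegree_mul (add_mem hs ht), Prod.fst_add, Prod.snd_add]
  ring

theorem monomialCurveDegree_eq_one {a b : ℕ} (hb : 0 < a + b) {s : ℕ × ℕ}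
    (hs : s ∈ ({(0, a + b), (a, a + b - a), (b, a + b - b), (a + b, 0)} : Set (ℕ × ℕ))) :
    monomialCurveDegree (a + b) s = 1 := by
  refine Nat.eq_of_mul_eq_mul_right hb ?_
  rw [monomialCurveDegree_mul (AddSubmonoid.subset_closure hs)]
  rcases hs with rfl | rfl | rfl | rfl <;> simp; omega

open MvPolynomial in
theorem monomial_mem_symmetricIdeal_pow (K : Type*) [Field K] {a b : ℕ} (hb : 0 < a + b)
    {s : ℕ × ℕ} (hs : s ∈ monomialCurveSemigroup a b (a + b)) :
    (X 0 ^ s.1 * X 1 ^ s.2 : MvPolynomial (Fin 2) K) ∈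
      symmetricIdeal K a b (a + b) ^ monomialCurveDegree (a + b) s := by
  induction hs using AddSubmonoid.closure_induction with
  | mem s hs =>
    rw [monomialCurveDegree_eq_one hb hs, pow_one]
    refine Ideal.subset_span ?_
    rcases hs with rfl | rfl | rfl | rfl <;> simp
  | zero => simp [monomialCurveDegree]
  | add s t hs ht hs' ht' =>
    rw [monomialCurveDegree_add hb hs ht, pow_add]
    convert Ideal.mul_mem_mul hs' ht' using 1
    simp only [Prod.fst_add, Prod.snd_add]
    ring

open MvPolynomial in
/-- The embedding of the homogeneous coordinate ring of a projective monomial curve into the Rees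
algebra of the ideal generated by its monomial parametrization. -/
noncomputable def monomialCurveRingToRees (K : Type*) [Field K] {a b : ℕ} (hb : 0 < a + b) :
    MonomialCurveRing K a b (a + b) →ₐ[K] reesAlgebra (symmetricIdeal K a b (a + b)) :=
  AddMonoidAlgebra.lift K _ _
    { toFun s := ⟨Polynomial.monomial (monomialCurveDegree (a + b) s.toAdd.1)
          (X 0 ^ s.toAdd.1.1 * X 1 ^ s.toAdd.1.2),
        reesAlgebra.monomial_mem.mpr (monomial_mem_symmetricIdeal_pow K hb s.toAdd.2)⟩
      map_one' := Subtype.ext (by simp [monomialCurveDegree])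
      map_mul' s t := Subtype.ext (by
        simp only [toAdd_mul, AddSubmonoid.coe_add, MulMemClass.coe_mul,
          Polynomial.monomial_mul_monomial, Prod.fst_add, Prod.snd_add,
          monomialCurveDegree_add hb s.toAdd.2 t.toAdd.2]
        congr 1
        ring) }

open MvPolynomial in
theorem monomialCurveRingToRees_single {K : Type*} [Field K] {a b : ℕ} (hb : 0 < a + b)
    (s : monomialCurveSemigroup a b (a + b)) (r : K) :
    (monomialCurveRingToRees K hb (single s r)).1 =
      Polynomial.monomial (monomialCurveDegree (a + b) s.1)
        (r • (X 0 ^ s.1.1 * X 1 ^ s.1.2)) := by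
  rw [← Polynomial.smul_monomial]
  simp only [monomialCurveRingToRees, AddMonoidAlgebra.lift_single]
  rfl

open MvPolynomial in
theorem coeff_monomialCurveRingToRees {K : Type*} [Field K] {a b : ℕ} (hb : 0 < a + b)
    (f : MonomialCurveRing K a b (a + b)) (s : monomialCurveSemigroup a b (a + b)) :
    (((monomialCurveRingToRees K hb f).1.coeff (monomialCurveDegree (a + b) s.1)).coeff
      (Finsupp.single 0 s.1.1 + Finsupp.single 1 s.1.2)) = f.coeff s := by
  classical
  induction f using AddMonoidAlgebra.induction_linear with
  | zero => simp
  | add f g hf hg =>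
    rw [map_add, AddMonoidAlgebra.coeff_add, Finsupp.add_apply, ← hf, ← hg]
    simp
  | single t r =>
    have hmon : r • (X 0 ^ t.1.1 * X 1 ^ t.1.2) =
        monomial (Finsupp.single 0 t.1.1 + Finsupp.single 1 t.1.2 : Fin 2 →₀ ℕ) r := by
      rw [X_pow_eq_monomial, X_pow_eq_monomial, monomial_mul, smul_monomial]
      simp
    rw [monomialCurveRingToRees_single, hmon, Polynomial.coeff_monomial,
      AddMonoidAlgebra.coeff_single, Finsupp.single_apply]
    by_cases hts : t = s
    · subst hts
      simp
    · have hne : (Finsupp.single 0 t.1.1 + Finsupp.single 1 t.1.2 : Fin 2 →₀ ℕ) ≠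
          Finsupp.single 0 s.1.1 + Finsupp.single 1 s.1.2 := fun h => hts <| Subtype.ext <| by
        have h0 := DFunLike.congr_fun h 0
        have h1 := DFunLike.congr_fun h 1
        simp at h0 h1
        exact Prod.ext h0 h1
      split_ifs <;> simp [coeff_monomial, hne]

/-- The homomorphism from the homogeneous coordinate ring of the projective monomial curve to the
fiber cone. -/
noncomputable def monomialCurveRingToFiberCone (K : Type*) [Field K] {a b : ℕ} (hb : 0 < a + b) :
    MonomialCurveRing K a b (a + b) →ₐ[K] FiberCone (symmetricIdeal K a b (a + b)) :=
  (Ideal.Quotient.mkₐ K _).comp (monomialCurveRingToRees K hb)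

/-- A degree count: an element of `𝔪 I ^ n` has only terms of degree above `n * (a + b)`, while an
element of `S` of degree `n` gives a monomial of degree exactly `n * (a + b)`. -/
theorem monomialCurveRingToFiberCone_injective (K : Type*) [Field K] {a b : ℕ} (hb : 0 < a + b) :
    Function.Injective (monomialCurveRingToFiberCone K hb) := by
  rw [injective_iff_map_eq_zero]
  intro f hf
  rw [monomialCurveRingToFiberCone, AlgHom.comp_apply, Ideal.Quotient.mkₐ_eq_mk,
    Ideal.Quotient.eq_zero_iff_mem] at hf
  ext s
  rw [← coeff_monomialCurveRingToRees hb f s]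
  have hmem := coeff_mem_of_mem_map_reesAlgebra hf (monomialCurveDegree (a + b) s.1)
  have hle : variablesIdeal (Fin 2) K *
      symmetricIdeal K a b (a + b) ^ monomialCurveDegree (a + b) s.1 ≤
        MvPolynomial.idealOfVars (Fin 2) K ^ (s.1.1 + s.1.2 + 1) := by
    rw [← monomialCurveDegree_mul s.2, mul_comm _ (a + b), pow_succ', pow_mul]
    exact Ideal.mul_mono_right (Ideal.pow_right_mono (symmetricIdeal_le_variablesIdeal_pow K a b) _)
  exact (MvPolynomial.mem_pow_idealOfVars_iff' _ _).mp (hle hmem) _ (by simp)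

open MvPolynomial in
-- The Rees algebra is generated over `K[x, y]` by `I` in degree one. Modulo `𝔪` the polynomial
-- coefficients become scalars, and the generators of `I` come from those of `S`.
theorem monomialCurveRingToFiberCone_surjective (K : Type*) [Field K] {a b : ℕ} (hb : 0 < a + b) :
    Function.Surjective (monomialCurveRingToFiberCone K hb) := by
  let I := symmetricIdeal K a b (a + b)
  let φ := monomialCurveRingToFiberCone K hb
  have hbase (p : MvPolynomial (Fin 2) K) :
      (Ideal.Quotient.mk _ (algebraMap _ (reesAlgebra I) p) : FiberCone I) ∈ φ.range := by
    induction p using MvPolynomial.induction_on with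
    | C r => exact φ.range.algebraMap_mem r
    | add p q hp hq => rw [map_add, map_add]; exact add_mem hp hq
    | mul_X p i hp =>
      rw [map_mul, map_mul]
      refine mul_mem hp ?_
      have hX : (X i : MvPolynomial (Fin 2) K) ∈ variablesIdeal (Fin 2) K :=
        Ideal.subset_span (Set.mem_range_self i)
      rw [Ideal.Quotient.eq_zero_iff_mem.mpr (Ideal.mem_map_of_mem _ hX)]
      exact zero_mem _
  have hmonomial {s : ℕ × ℕ}
      (hs : s ∈ ({(0, a + b), (a, a + b - a), (b, a + b - b), (a + b, 0)} : Set (ℕ × ℕ)))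
      (h : Polynomial.monomial 1 (X 0 ^ s.1 * X 1 ^ s.2) ∈ reesAlgebra I) :
      (Ideal.Quotient.mk _ ⟨_, h⟩ : FiberCone I) ∈ φ.range := by
    refine ⟨single ⟨s, AddSubmonoid.subset_closure hs⟩ 1, ?_⟩
    refine congrArg (Ideal.Quotient.mk _) (Subtype.ext ?_)
    refine (monomialCurveRingToRees_single hb _ 1).trans ?_
    rw [one_smul, monomialCurveDegree_eq_one hb hs]
  have hgen (f : MvPolynomial (Fin 2) K) (hf : f ∈ I)
      (h : Polynomial.monomial 1 f ∈ reesAlgebra I) :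
      (Ideal.Quotient.mk _ ⟨_, h⟩ : FiberCone I) ∈ φ.range := by
    induction hf using Submodule.span_induction with
    | mem f hf =>
      obtain ⟨s, hs, rfl⟩ : ∃ s ∈ ({(0, a + b), (a, a + b - a), (b, a + b - b), (a + b, 0)} :
          Set (ℕ × ℕ)), X 0 ^ s.1 * X 1 ^ s.2 = f := by
        rcases hf with rfl | rfl | rfl | rfl
        · exact ⟨(a + b, 0), by simp⟩
        · exact ⟨(b, a + b - b), by simp⟩
        · exact ⟨(a, a + b - a), by simp⟩
        · exact ⟨(0, a + b), by simp⟩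
      exact hmonomial hs h
    | zero =>
      convert zero_mem φ.range
      rw [← map_zero (Ideal.Quotient.mk _)]
      exact congrArg (Ideal.Quotient.mk _) (Subtype.ext (map_zero _))
    | add f g hf hg hf' hg' =>
      have hf := reesAlgebra.monomial_mem.mpr ((pow_one I).symm.le hf)
      have hg := reesAlgebra.monomial_mem.mpr ((pow_one I).symm.le hg)
      convert add_mem (hf' hf) (hg' hg) using 1
      rw [← map_add]
      exact congrArg (Ideal.Quotient.mk _) (Subtype.ext (map_add _ f g))
    | smul p f hf hf' =>
      have hf := reesAlgebra.monomial_mem.mpr ((pow_one I).symm.le hf)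
      convert mul_mem (hbase p) (hf' hf) using 1
      rw [← map_mul]
      exact congrArg (Ideal.Quotient.mk _) (Subtype.ext (Polynomial.C_mul_monomial.symm))
  rw [← AlgHom.range_eq_top, eq_top_iff]
  rintro r -
  obtain ⟨⟨r, hr⟩, rfl⟩ := Ideal.Quotient.mk_surjective r
  have hr' := hr
  rw [← adjoin_monomial_eq_reesAlgebra] at hr'
  induction hr' using Algebra.adjoin_induction with
  | mem r hr' =>
    obtain ⟨f, hf, rfl⟩ := hr'
    exact hgen f hf hr
  | algebraMap p => exact hbase p
  | add r s hr₁ hs₁ hr₂ hs₂ =>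
    rw [adjoin_monomial_eq_reesAlgebra] at hr₁ hs₁
    exact add_mem (hr₂ hr₁) (hs₂ hs₁)
  | mul r s hr₁ hs₁ hr₂ hs₂ =>
    rw [adjoin_monomial_eq_reesAlgebra] at hr₁ hs₁
    exact mul_mem (hr₂ hr₁) (hs₂ hs₁)

theorem theorem3p3 {K : Type*} [Field K] (a b : ℕ) (ha : 0 < a) (hab : a < b)
    (hgcd : Nat.gcd a b = 1) :
    Nonempty (FiberCone (symmetricIdeal K a b (a + b)) ≃ₐ[K] MonomialCurveRing K a b (a + b)) ∧
      (IsCohenMacaulayRing (FiberCone (symmetricIdeal K a b (a + b))) ↔ b = a + 1) := by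
  have hb : 0 < a + b := by omega
  let e := AlgEquiv.ofBijective (monomialCurveRingToFiberCone K hb)
    ⟨monomialCurveRingToFiberCone_injective K hb, monomialCurveRingToFiberCone_surjective K hb⟩
  refine ⟨⟨e.symm⟩, fun h => ?_, ?_⟩
  · by_contra hne
    exact not_isCohenMacaulayRing_monomialCurveRing K ha (by omega) hgcd
      (h.of_ringEquiv e.symm.toRingEquiv)
  · rintro rfl
    exact (isCohenMacaulayRing_monomialCurveRing K a).of_ringEquiv e.toRingEquiv
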